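/- For an integer $K\ge 0$, let $\mathbb{O}_K$ be the complex square matrix whose rows and columns are indexed by the independent sets of the $K$-point segment (that is, the subsets of $\{1,\dots,K\}$ containing no two consecutive integers), with entries $$\mathbb{O}_K(C,D)=\begin{cases} i^{|C|+|D|} & \text{if } C\cap D=\emptyset,\\ 0 & \text{otherwise.}\end{cases}$$ Then the following hold. - If $K\equiv 1 \pmod 3$, then $e^{i\pi/3}$ and $e^{-i\pi/3}$ are eigenvalues of $\mathbb{O}_K$. - If $K\equiv 2 \pmod 3$, then every complex number $z$ with $z^{2K}=1$ and $z\ne -1$ is an eigenvalue of $\mathbb{O}_K$. - If $K\equiv 0 \pmod 3$, then every complex number $z$ with $z^{2K+2}=1$ and $z\ne -1$ is an eigenvalue of $\mathbb{O}_K$, with the additional exclusion of $z=\pm i$ when $K$ is odd. (Nothing is asserted about the excluded values.) -/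

import Mathlib

/-- The independent sets of the `K`-point segment (the path graph on `K` vertices): sets of
vertices that do not contain two consecutive vertices. -/
abbrev SegmentIndepSet (K : ℕ) : Type :=
  {C : Finset (Fin K) // (SimpleGraph.pathGraph K).IsIndepSet (C : Set (Fin K))}

noncomputable instance SegmentIndepSet.instFintype (K : ℕ) : Fintype (SegmentIndepSet K) :=
  Fintype.ofFinite _

/-- The transfer matrix of the ordinary cylinder of width `K`: its rows and columns are indexed
by the independent sets of the `K`-point segment, and its `(C, D)` entry is `i ^ (|C| + |D|)` if
`C` and `D` are disjoint, and `0` otherwise. -/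
noncomputable def transferMatrixO (K : ℕ) :
    Matrix (SegmentIndepSet K) (SegmentIndepSet K) ℂ :=
  Matrix.of fun C D =>
    if Disjoint C.1 D.1 then Complex.I ^ (C.1.card + D.1.card) else 0

/-! Let T be the transfer matrix and let v(X, F) be the vector with entry i^|D| at those independent
sets D that contain X and avoid F (`cylinderVector`). The entry of T v(X, F) at E is i^|E| times the
signed count, with weight (-1)^|D|, of the D that contain X and avoid F and E. Such a signed count
vanishes if the available positions include an isolated point, and each isolated edge contributes
the factor 1 - 1 - 1 = -1. So if the positions left free by X and F split into isolated points S and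
isolated edges L, then E must contain S and miss X and every edge, and T v(X, F) = ± v(S, F') with
F' made of X and the edges (`toLin'_cylinderVector`).

Sets of period 3 give closed orbits of such vectors. For K = 3k + 1 there is a 3-cycle with total
sign -1. For K = 3k + 2 a vector is carried to ± its mirror image in K steps, and for K = 3k in K +
1 steps. Hence T^N v = v with N = 2K or N = 2K + 2.

When T^N v = z^N v, the sum of z^(-t) T^t v over t < N is fixed by z⁻¹ T, so it is an eigenvector
unless it is zero (`hasEigenvalue_of_pow_apply`). Nonvanishing is tested at one coordinate: the
empty set for K = 3k + 1, and {0, 3, 6, …} for K = 3k + 2 and for K = 3k > 0. In the latter two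
cases the coordinate is essentially a geometric sum in z⁻³, whose zeros lie among the excluded
values of z. -/

/-! ### Signed counts of sparse sets -/

/-- A set of naturals without two consecutive elements. -/
def IsSparse (D : Finset ℕ) : Prop := ∀ p ∈ D, p + 1 ∉ D

instance (D : Finset ℕ) : Decidable (IsSparse D) := by unfold IsSparse; infer_instance

/-- The weight `(-1) ^ |D|` of a set without consecutive elements, and `0` for other sets. -/
def sparseSign (D : Finset ℕ) : ℂ := if IsSparse D then (-1) ^ D.card else 0

/-- The signed count of the subsets of `W` without consecutive elements. -/
def sparseCount (W : Finset ℕ) : ℂ := ∑ D ∈ W.powerset, sparseSign D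

theorem sparseSign_insert {a : ℕ} {D : Finset ℕ} (ha : a ∉ D) (h1 : a + 1 ∉ D)
    (h2 : ∀ p ∈ D, p + 1 ≠ a) : sparseSign (insert a D) = -sparseSign D := by
  have h : IsSparse (insert a D) ↔ IsSparse D := by
    unfold IsSparse
    constructor
    · intro h p hp hq
      exact h p (Finset.mem_insert_of_mem hp) (Finset.mem_insert_of_mem hq)
    · intro h p hp hq
      rw [Finset.mem_insert] at hp hq
      rcases hp with rfl | hp
      · rcases hq with hq | hq
        · omega
        · exact h1 hq
      · rcases hq with hq | hq
        · exact h2 p hp hq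
        · exact h p hp hq
  unfold sparseSign
  simp only [h, Finset.card_insert_of_notMem ha]
  split_ifs <;> ring

/-- Toggling the isolated position `a` is a sign-reversing pairing of the sparse subsets. -/
theorem sparseCount_eq_zero {a : ℕ} {W : Finset ℕ} (ha : a ∈ W) (h1 : a + 1 ∉ W)
    (h2 : ∀ p ∈ W, p + 1 ≠ a) : sparseCount W = 0 := by
  obtain ⟨V, hV, rfl⟩ : ∃ V, a ∉ V ∧ W = insert a V :=
    ⟨W.erase a, Finset.notMem_erase a W, (Finset.insert_erase ha).symm⟩
  unfold sparseCount
  rw [Finset.sum_powerset_insert hV, ← Finset.sum_add_distrib]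
  refine Finset.sum_eq_zero fun D hD => ?_
  rw [Finset.mem_powerset] at hD
  rw [sparseSign_insert (fun h => hV (hD h))
    (fun h => h1 (Finset.mem_insert_of_mem (hD h)))
    (fun p hp => h2 p (Finset.mem_insert_of_mem (hD hp)))]
  ring

/-- An isolated edge has the independent sets ∅, {a}, {a + 1}, with signed count 1 - 1 - 1. -/
theorem sparseCount_edge {a : ℕ} {V : Finset ℕ} (ha : a ∉ V) (h1 : a + 1 ∉ V)
    (h2 : a + 2 ∉ V) (h3 : ∀ p ∈ V, p + 1 ≠ a) :
    sparseCount (insert a (insert (a + 1) V)) = -sparseCount V := by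
  -- Subsets avoiding `a` cancel, since `a + 1` is then isolated; only those containing `a` remain.
  have hb : sparseCount (insert (a + 1) V) = 0 := by
    refine sparseCount_eq_zero (a := a + 1) (Finset.mem_insert_self _ _) ?_ ?_
    · simp [h2]
    · intro p hp
      rw [Finset.mem_insert] at hp
      rcases hp with rfl | hp
      · omega
      · rintro hpa
        have : p = a := by omega
        exact ha (this ▸ hp)
  unfold sparseCount at hb ⊢
  rw [Finset.sum_powerset_insert (by simp [ha]), hb, zero_add,
    Finset.sum_powerset_insert h1, ← Finset.sum_neg_distrib]
  have hz : ∑ D ∈ V.powerset, sparseSign (insert a (insert (a + 1) D)) = 0 := by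
    refine Finset.sum_eq_zero fun D _ => ?_
    unfold sparseSign
    rw [if_neg]
    intro h
    exact h a (by simp) (by simp)
  rw [hz, add_zero]
  refine Finset.sum_congr rfl fun D hD => ?_
  rw [Finset.mem_powerset] at hD
  exact sparseSign_insert (fun h => ha (hD h)) (fun h => h1 (hD h)) (fun p hp => h3 p (hD hp))

theorem sparseCount_edges (L : Finset ℕ) (h : ∀ p ∈ L, p + 1 ∉ L ∧ p + 2 ∉ L) :
    sparseCount (L ∪ L.image (· + 1)) = (-1) ^ L.card := by
  induction L using Finset.induction_on with
  | empty => simp [sparseCount, sparseSign, IsSparse]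
  | insert a L ha ih =>
    have key : insert a L ∪ (insert a L).image (· + 1)
        = insert a (insert (a + 1) (L ∪ L.image (· + 1))) := by
      ext p; simp; tauto
    have hL : ∀ p ∈ L, p ≠ a ∧ p ≠ a + 1 ∧ p ≠ a + 2 ∧ a ≠ p + 1 ∧ a ≠ p + 2 := by
      intro p hp
      have h1 := h p (Finset.mem_insert_of_mem hp)
      have h2 := h a (Finset.mem_insert_self _ _)
      simp only [Finset.mem_insert, not_or] at h1 h2
      refine ⟨fun e => ha (e ▸ hp), fun e => h2.1.2 (e ▸ hp), fun e => h2.2.2 (e ▸ hp),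
        fun e => h1.1.1 e.symm, fun e => h1.2.1 e.symm⟩
    rw [key, sparseCount_edge, ih, Finset.card_insert_of_notMem ha, pow_succ]
    · ring
    · intro p hp
      have h1 := h p (Finset.mem_insert_of_mem hp)
      simp only [Finset.mem_insert, not_or] at h1
      exact ⟨h1.1.2, h1.2.2⟩
    all_goals simp only [Finset.mem_union, Finset.mem_image, not_or, not_exists, not_and]
    · exact ⟨ha, fun p hp => by have := hL p hp; omega⟩
    · exact ⟨fun hp => by have := hL _ hp; omega, fun p hp => by have := hL p hp; omega⟩
    · exact ⟨fun hp => by have := hL _ hp; omega, fun p hp => by have := hL p hp; omega⟩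
    · rintro p (hp | ⟨q, hq, rfl⟩)
      · have := hL p hp; omega
      · have := hL q hq; omega

/-! ### Independent sets of the segment as sets of naturals -/

/-- The set of positions of an independent set of the segment. -/
def SegmentIndepSet.support {K : ℕ} (D : SegmentIndepSet K) : Finset ℕ :=
  D.1.map Fin.valEmbedding

theorem SegmentIndepSet.card_support {K : ℕ} (D : SegmentIndepSet K) :
    D.support.card = D.1.card := Finset.card_map _

theorem SegmentIndepSet.disjoint_support {K : ℕ} (C D : SegmentIndepSet K) :
    Disjoint C.support D.support ↔ Disjoint C.1 D.1 := Finset.disjoint_map _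

theorem SegmentIndepSet.support_subset {K : ℕ} (D : SegmentIndepSet K) :
    D.support ⊆ Finset.range K := by
  intro p hp
  obtain ⟨q, _, rfl⟩ := Finset.mem_map.1 hp
  exact Finset.mem_range.2 q.2

theorem SegmentIndepSet.isSparse_support {K : ℕ} (D : SegmentIndepSet K) :
    IsSparse D.support := by
  intro p hp hp'
  obtain ⟨q, hq, rfl⟩ := Finset.mem_map.1 hp
  obtain ⟨r, hr, hqr⟩ := Finset.mem_map.1 hp'
  have hqr' : (r : ℕ) = q + 1 := hqr
  refine D.2 hq hr (fun e => ?_) ?_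
  · rw [e] at hqr'; omega
  · rw [SimpleGraph.pathGraph_adj]; exact Or.inl hqr'.symm

theorem SegmentIndepSet.support_injective {K : ℕ} :
    Function.Injective (SegmentIndepSet.support (K := K)) := fun _ _ h =>
  Subtype.ext (Finset.map_injective _ h)

theorem SegmentIndepSet.exists_support_eq {K : ℕ} {E : Finset ℕ} (hE : E ⊆ Finset.range K)
    (h : IsSparse E) : ∃ D : SegmentIndepSet K, D.support = E := by
  refine ⟨⟨Finset.univ.filter fun q : Fin K => (q : ℕ) ∈ E, ?_⟩, ?_⟩
  · intro p hp q hq _ hadj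
    simp only [Finset.coe_filter, Finset.mem_univ, true_and, Set.mem_ofPred_eq] at hp hq
    rw [SimpleGraph.pathGraph_adj] at hadj
    rcases hadj with e | e
    · exact h _ hp (e ▸ hq)
    · exact h _ hq (e ▸ hp)
  · ext p
    simp only [SegmentIndepSet.support, Finset.mem_map, Finset.mem_filter, Finset.mem_univ,
      true_and, Fin.valEmbedding_apply]
    constructor
    · rintro ⟨q, hq, rfl⟩; exact hq
    · intro hp; exact ⟨⟨p, Finset.mem_range.1 (hE hp)⟩, hp, rfl⟩

theorem SegmentIndepSet.sum_support {K : ℕ} (g : Finset ℕ → ℂ) :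
    ∑ D : SegmentIndepSet K, g D.support
      = ∑ E ∈ (Finset.range K).powerset with IsSparse E, g E := by
  refine Finset.sum_bij (fun D _ => D.support) ?_ ?_ ?_ ?_
  · intro D _
    simp [D.support_subset, D.isSparse_support]
  · intro C _ D _ h
    exact SegmentIndepSet.support_injective h
  · intro E hE
    rw [Finset.mem_filter, Finset.mem_powerset] at hE
    obtain ⟨D, hD⟩ := SegmentIndepSet.exists_support_eq hE.1 hE.2
    exact ⟨D, Finset.mem_univ _, hD⟩
  · intro _ _; rfl

/-! ### Action of the transfer matrix on cylinder vectors -/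

/-- Removing `X` from `D` leaves an arbitrary sparse subset of `W`, the positions outside `G` that
neither lie in `X` nor touch it. -/
theorem sum_sparse_eq {K : ℕ} {X G W : Finset ℕ} (hXK : X ⊆ Finset.range K) (hX : IsSparse X)
    (hXG : Disjoint X G)
    (hW : ∀ p, p ∈ W ↔ p < K ∧ p ∉ G ∧ p ∉ X ∧ p + 1 ∉ X ∧ ∀ q ∈ X, q + 1 ≠ p) :
    (∑ D ∈ (Finset.range K).powerset with IsSparse D,
      if X ⊆ D ∧ Disjoint D G then (-1 : ℂ) ^ D.card else 0)
      = (-1) ^ X.card * sparseCount W := by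
  have hXW : Disjoint X W := Finset.disjoint_left.2 fun p hp hpW => ((hW p).1 hpW).2.2.1 hp
  unfold sparseCount sparseSign
  rw [← Finset.sum_filter, ← Finset.sum_filter, Finset.mul_sum, Finset.filter_filter]
  refine Finset.sum_nbij' (fun D => D \ X) (fun D => X ∪ D) ?_ ?_ ?_ ?_ ?_
  · intro D hD
    simp only [Finset.mem_filter, Finset.mem_powerset] at hD ⊢
    obtain ⟨hDK, hD, hXD, hDG⟩ := hD
    refine ⟨fun p hp => ?_, fun p hp hp' => ?_⟩
    · rw [Finset.mem_sdiff] at hp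
      refine (hW p).2 ⟨Finset.mem_range.1 (hDK hp.1), Finset.disjoint_left.1 hDG hp.1, hp.2,
        fun h => hD p hp.1 (hXD h), fun q hq h => hD q (hXD hq) (h ▸ hp.1)⟩
    · exact hD p (Finset.mem_sdiff.1 hp).1 (Finset.mem_sdiff.1 hp').1
  · intro D hD
    simp only [Finset.mem_filter, Finset.mem_powerset] at hD ⊢
    obtain ⟨hDW, hD⟩ := hD
    refine ⟨Finset.union_subset hXK fun p hp => Finset.mem_range.2 ((hW p).1 (hDW hp)).1, ?_,
      Finset.subset_union_left, Finset.disjoint_union_left.2 ⟨hXG, ?_⟩⟩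
    · intro p hp hp'
      rw [Finset.mem_union] at hp hp'
      rcases hp with hp | hp <;> rcases hp' with hp' | hp'
      · exact hX p hp hp'
      · exact ((hW _).1 (hDW hp')).2.2.2.2 p hp rfl
      · exact ((hW _).1 (hDW hp)).2.2.2.1 hp'
      · exact hD p hp hp'
    · exact Finset.disjoint_left.2 fun p hp => ((hW p).1 (hDW hp)).2.1
  · intro D hD
    simp only [Finset.mem_filter] at hD
    exact Finset.union_sdiff_of_subset hD.2.2.1
  · intro D hD
    simp only [Finset.mem_filter, Finset.mem_powerset] at hD
    exact Finset.union_sdiff_cancel_left (hXW.mono_right hD.1)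
  · intro D hD
    simp only [Finset.mem_filter] at hD
    rw [← pow_add, add_comm, Finset.card_sdiff_add_card_eq_card hD.2.2.1]

/-- The vector supported on the independent sets that contain `X` and avoid `F`, with
entry `i ^ |D|` at such a set `D`. -/
noncomputable def cylinderVector (K : ℕ) (X F : Finset ℕ) : SegmentIndepSet K → ℂ := fun D =>
  if X ⊆ D.support ∧ Disjoint D.support F then Complex.I ^ D.support.card else 0

/-- The factors i^|D| of the matrix and of the vector combine to the sign (-1)^|D|, and `E` just
joins the forbidden set. -/
theorem toLin'_cylinderVector_apply {K : ℕ} (X F : Finset ℕ) (E : SegmentIndepSet K) :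
    Matrix.toLin' (transferMatrixO K) (cylinderVector K X F) E
      = Complex.I ^ E.support.card * ∑ D ∈ (Finset.range K).powerset with IsSparse D,
          if X ⊆ D ∧ Disjoint D (F ∪ E.support) then (-1 : ℂ) ^ D.card else 0 := by
  rw [← SegmentIndepSet.sum_support (K := K)
    (fun D => if X ⊆ D ∧ Disjoint D (F ∪ E.support) then (-1 : ℂ) ^ D.card else 0)]
  rw [Matrix.toLin'_apply, Matrix.mulVec, dotProduct, Finset.mul_sum]
  refine Finset.sum_congr rfl fun D _ => ?_
  simp only [transferMatrixO, Matrix.of_apply, cylinderVector, Finset.disjoint_union_right,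
    ← SegmentIndepSet.disjoint_support, ← SegmentIndepSet.card_support]
  simp only [disjoint_comm (a := E.support) (b := D.support)]
  by_cases h1 : Disjoint D.support E.support <;>
    by_cases h2 : X ⊆ D.support ∧ Disjoint D.support F
  · rw [if_pos h1, if_pos h2, if_pos ⟨h2.1, h2.2, h1⟩, pow_add, mul_assoc, ← mul_pow,
      Complex.I_mul_I]
  · rw [if_neg h2, mul_zero, if_neg fun h => h2 ⟨h.1, h.2.1⟩, mul_zero]
  · rw [if_neg h1, zero_mul, if_neg fun h => h1 h.2.2, mul_zero]
  · rw [if_neg h1, zero_mul, if_neg fun h => h1 h.2.2, mul_zero]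

/-- If the positions that are neither in `F` nor in or next to `X` form a disjoint union of
isolated points `S` and of isolated edges with left ends `L`, then the transfer matrix maps one
cylinder vector to another, up to sign. -/
theorem toLin'_cylinderVector {K : ℕ} {X F S L F' : Finset ℕ} (hXK : ∀ p ∈ X, p < K)
    (hX : ∀ p ∈ X, p + 1 ∉ X ∧ p ∉ F)
    (hS : ∀ p ∈ S, p + 1 ∉ S ∧ p ∉ L ∧ p + 1 ∉ L ∧ ∀ q ∈ L, q + 1 ≠ p ∧ q + 2 ≠ p)
    (hL : ∀ p ∈ L, p + 1 ∉ L ∧ p + 2 ∉ L)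
    (hW : ∀ p, (p < K ∧ p ∉ F ∧ p ∉ X ∧ p + 1 ∉ X ∧ ∀ q ∈ X, q + 1 ≠ p) ↔
      (p ∈ S ∨ p ∈ L ∨ ∃ q ∈ L, q + 1 = p))
    (hF' : ∀ p < K, p ∈ F' ↔ p ∈ X ∨ p ∈ L ∨ ∃ q ∈ L, q + 1 = p) :
    Matrix.toLin' (transferMatrixO K) (cylinderVector K X F)
      = (-1 : ℂ) ^ (X.card + L.card) • cylinderVector K S F' := by
  funext E
  have hEK : ∀ p ∈ E.support, p < K := fun p hp => Finset.mem_range.1 (E.support_subset hp)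
  have hE := E.isSparse_support
  rw [toLin'_cylinderVector_apply, Pi.smul_apply, smul_eq_mul, cylinderVector]
  -- If `E` meets `X`, no admissible `D` exists; on the right, `E` meets `F'`, which contains `X`.
  by_cases hXE : Disjoint X E.support
  swap
  · rw [Finset.sum_eq_zero, mul_zero, if_neg, mul_zero]
    · rintro ⟨-, h⟩
      refine hXE (Finset.disjoint_left.2 fun p hp hpE => ?_)
      exact Finset.disjoint_left.1 h hpE ((hF' p (hXK p hp)).2 (Or.inl hp))
    · intro D _
      refine if_neg fun h => hXE ?_
      exact (Finset.disjoint_union_right.1 (h.2.mono_left h.1)).2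
  obtain ⟨W, hWdef⟩ : ∃ W, W = (S ∪ (L ∪ L.image (· + 1))) \ E.support := ⟨_, rfl⟩
  have memW : ∀ p, p ∈ W ↔ (p ∈ S ∨ p ∈ L ∨ ∃ q ∈ L, q + 1 = p) ∧ p ∉ E.support := by
    intro p; simp [hWdef]
  rw [sum_sparse_eq (W := W) (fun p hp => Finset.mem_range.2 (hXK p hp)) (fun p hp => (hX p hp).1)
    (Finset.disjoint_union_right.2 ⟨Finset.disjoint_left.2 fun p hp => (hX p hp).2, hXE⟩)
    (fun p => by rw [memW, ← hW, Finset.mem_union]; tauto)]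
  -- A point of `S` outside `E` is an isolated point of `W`, so the count vanishes.
  by_cases hSE : S ⊆ E.support
  swap
  · obtain ⟨a, haS, haE⟩ := Finset.not_subset.1 hSE
    have ha := hS a haS
    rw [sparseCount_eq_zero (a := a) ((memW a).2 ⟨Or.inl haS, haE⟩), if_neg fun h => hSE h.1]
    · ring
    · rw [memW]
      rintro ⟨h | h | ⟨q, hq, h⟩, -⟩
      · exact ha.1 h
      · exact ha.2.2.1 h
      · rw [Nat.add_right_cancel_iff.1 h] at hq
        exact ha.2.1 hq
    · rintro p hp rfl
      rcases ((memW p).1 hp).1 with h | h | ⟨q, hq, h⟩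
      · exact (hS p h).1 haS
      · exact (ha.2.2.2 p h).1 rfl
      · exact (ha.2.2.2 q hq).2 (by omega)
  by_cases hLE : ∀ p ∈ L, p ∉ E.support ∧ p + 1 ∉ E.support
  · have hWL : W = L ∪ L.image (· + 1) := by
      ext p
      rw [memW]
      simp only [Finset.mem_union, Finset.mem_image]
      constructor
      · rintro ⟨h | h, hp⟩
        · exact absurd (hSE h) hp
        · exact h
      · intro h
        refine ⟨Or.inr h, ?_⟩
        rcases h with h | ⟨q, hq, rfl⟩
        · exact (hLE p h).1
        · exact (hLE q hq).2
    rw [hWL, sparseCount_edges L hL, if_pos, pow_add]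
    · ring
    · refine ⟨hSE, Finset.disjoint_left.2 fun p hp hpF => ?_⟩
      rcases (hF' p (hEK p hp)).1 hpF with h | h | ⟨q, hq, rfl⟩
      · exact Finset.disjoint_left.1 hXE h hp
      · exact (hLE p h).1 hp
      · exact (hLE q hq).2 hp
  -- Being sparse, `E` contains exactly one end of this edge; the other end becomes isolated in `W`,
  -- so the count vanishes.
  · push Not at hLE
    obtain ⟨a, haL, hab⟩ := hLE
    have ha := hL a haL
    have hbE : a ∈ E.support ∨ a + 1 ∈ E.support := by
      by_cases h : a ∈ E.support
      · exact Or.inl h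
      · exact Or.inr (hab h)
    have hbS : a ∉ S ∧ a + 1 ∉ S ∧ a + 2 ∉ S :=
      ⟨fun h => (hS _ h).2.1 haL, fun h => ((hS _ h).2.2.2 a haL).1 rfl,
        fun h => ((hS _ h).2.2.2 a haL).2 rfl⟩
    have hW0 : sparseCount W = 0 := by
      rcases hbE with haE | hbE
      · refine sparseCount_eq_zero (a := a + 1)
          ((memW _).2 ⟨Or.inr (Or.inr ⟨a, haL, rfl⟩), hE a haE⟩) ?_ ?_
        · rw [memW]
          rintro ⟨h | h | ⟨q, hq, h⟩, -⟩
          · exact hbS.2.2 h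
          · exact ha.2 h
          · rw [show q = a + 1 by omega] at hq
            exact ha.1 hq
        · intro p hp e
          rw [show p = a by omega, memW] at hp
          exact hp.2 haE
      · refine sparseCount_eq_zero (a := a)
          ((memW _).2 ⟨Or.inr (Or.inl haL), fun h => hE a h hbE⟩) ?_ ?_
        · rw [memW]
          exact fun h => h.2 hbE
        · rintro p hp rfl
          rcases ((memW p).1 hp).1 with h | h | ⟨q, hq, h⟩
          · exact (hS p h).2.2.1 haL
          · exact (hL p h).1 haL
          · exact (hL q hq).2 (by rwa [show q + 2 = p + 1 by omega])
    rw [hW0, if_neg]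
    · ring
    · rintro ⟨-, h⟩
      rcases hbE with haE | hbE
      · exact Finset.disjoint_left.1 h haE ((hF' _ (hEK _ haE)).2 (Or.inr (Or.inl haL)))
      · exact Finset.disjoint_left.1 h hbE
          ((hF' _ (hEK _ hbE)).2 (Or.inr (Or.inr ⟨a, haL, rfl⟩)))

/-! ### Eigenvectors from periodic orbits -/

/-- Applying z⁻¹ T shifts the sum by one index, and the term gained at `N` equals the term lost at
0. -/
theorem hasEigenvalue_of_pow_apply {V : Type*} [AddCommGroup V] [Module ℂ V]
    {T : Module.End ℂ V} {v : V} {z : ℂ} {N : ℕ} (hz : z ≠ 0) (hv : (T ^ N) v = z ^ N • v)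
    (hw : ∑ t ∈ Finset.range N, z⁻¹ ^ t • (T ^ t) v ≠ 0) : T.HasEigenvalue z := by
  refine Module.End.hasEigenvalue_of_hasEigenvector (x := ∑ t ∈ Finset.range N, z⁻¹ ^ t • (T ^ t) v)
    ⟨Module.End.mem_eigenspace_iff.2 ?_, hw⟩
  have h1 : T (∑ t ∈ Finset.range N, z⁻¹ ^ t • (T ^ t) v)
      = z • ∑ t ∈ Finset.range N, z⁻¹ ^ (t + 1) • (T ^ (t + 1)) v := by
    rw [map_sum, Finset.smul_sum]
    refine Finset.sum_congr rfl fun t _ => ?_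
    rw [map_smul, smul_smul, pow_succ' z⁻¹, ← mul_assoc, mul_inv_cancel₀ hz, one_mul, pow_succ' T,
      Module.End.mul_apply]
  have h2 : (∑ t ∈ Finset.range N, z⁻¹ ^ (t + 1) • (T ^ (t + 1)) v) + v
      = (∑ t ∈ Finset.range N, z⁻¹ ^ t • (T ^ t) v) + v := by
    have h3 := Finset.sum_range_succ' (fun t => z⁻¹ ^ t • (T ^ t) v) N
    rw [Finset.sum_range_succ, hv, smul_smul, ← mul_pow, inv_mul_cancel₀ hz] at h3
    simpa using h3.symm
  rw [h1, add_right_cancel h2]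

/-! ### Sets of period 3 and evaluation of cylinder vectors -/

/-- The numbers `3 * i + r` with `a ≤ i < b`. -/
def progression (r a b : ℕ) : Finset ℕ := (Finset.Ico a b).image fun i => 3 * i + r

theorem mem_progression {r a b p : ℕ} :
    p ∈ progression r a b ↔ p % 3 = r % 3 ∧ 3 * a + r ≤ p ∧ p < 3 * b + r := by
  simp only [progression, Finset.mem_image, Finset.mem_Ico]
  constructor
  · rintro ⟨i, hi, rfl⟩; omega
  · intro h; exact ⟨(p - r) / 3, by omega, by omega⟩

theorem card_progression (r a b : ℕ) : (progression r a b).card = b - a := by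
  rw [progression, Finset.card_image_of_injective _ fun i j h => by simpa using h, Nat.card_Ico]

/-- With `p - 1 ∈ L` in place of an existential, each hypothesis for progressions becomes linear
arithmetic modulo 3 in `p`, within reach of `omega`. The guard `0 < p` is needed because subtraction
truncates. -/
theorem toLin'_cylinderVector_of_pred {K m : ℕ} {X F S F' : Finset ℕ} (L : Finset ℕ)
    (hm : X.card + L.card = m)
    (hX : ∀ p, p ∈ X → p < K ∧ p + 1 ∉ X ∧ p ∉ F)
    (hS : ∀ p, p ∈ S → p + 1 ∉ S ∧ p ∉ L ∧ p + 1 ∉ L)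
    (hL : ∀ p, p ∈ L → p + 1 ∉ L ∧ p + 2 ∉ L ∧ p + 1 ∉ S ∧ p + 2 ∉ S)
    (hW : ∀ p, (p < K ∧ p ∉ F ∧ p ∉ X ∧ p + 1 ∉ X ∧ ¬(0 < p ∧ p - 1 ∈ X)) ↔
      (p ∈ S ∨ p ∈ L ∨ 0 < p ∧ p - 1 ∈ L))
    (hF' : ∀ p, p < K → (p ∈ F' ↔ p ∈ X ∨ p ∈ L ∨ 0 < p ∧ p - 1 ∈ L)) :
    Matrix.toLin' (transferMatrixO K) (cylinderVector K X F)
      = (-1 : ℂ) ^ m • cylinderVector K S F' := by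
  subst hm
  have pred : ∀ (Y : Finset ℕ) (p : ℕ), (0 < p ∧ p - 1 ∈ Y) ↔ ∃ q ∈ Y, q + 1 = p := by
    intro Y p
    constructor
    · rintro ⟨h, hp⟩; exact ⟨p - 1, hp, by omega⟩
    · rintro ⟨q, hq, rfl⟩; exact ⟨by omega, hq⟩
  refine toLin'_cylinderVector (fun p hp => (hX p hp).1) (fun p hp => (hX p hp).2)
    (fun p hp => ⟨(hS p hp).1, (hS p hp).2.1, (hS p hp).2.2, fun q hq => ⟨?_, ?_⟩⟩)
    (fun p hp => ⟨(hL p hp).1, (hL p hp).2.1⟩) (fun p => ?_) (fun p hp => ?_)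
  · rintro rfl; exact (hL q hq).2.2.1 hp
  · rintro rfl; exact (hL q hq).2.2.2 hp
  · rw [← pred, ← hW, pred]
    simp only [not_exists, not_and, ne_eq]
  · rw [← pred, hF' p hp]

/-- The transfer matrix of the cylinder as an endomorphism. -/
noncomputable abbrev transferO (K : ℕ) : Module.End ℂ (SegmentIndepSet K → ℂ) :=
  Matrix.toLin' (transferMatrixO K)

theorem cylinderVector_apply_eq_zero {K : ℕ} {X F : Finset ℕ} {C : SegmentIndepSet K} (p : ℕ)
    (h : p ∈ X ∧ p ∉ C.support ∨ p ∈ C.support ∧ p ∈ F) : cylinderVector K X F C = 0 := by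
  refine if_neg fun hc => ?_
  rcases h with h | h
  · exact h.2 (hc.1 h.1)
  · exact Finset.disjoint_left.1 hc.2 h.1 h.2

theorem cylinderVector_apply_eq_pow {K : ℕ} {X F : Finset ℕ} {C : SegmentIndepSet K}
    (h : ∀ p, (p ∈ X → p ∈ C.support) ∧ (p ∈ C.support → p ∉ F)) :
    cylinderVector K X F C = Complex.I ^ C.support.card :=
  if_pos ⟨fun p => (h p).1, Finset.disjoint_left.2 fun p => (h p).2⟩

/-- The independent set `{0, 3, 6, …}` with `n` elements. -/
theorem exists_support_eq_progression {K n : ℕ} (h : 3 * n ≤ K + 2) :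
    ∃ C : SegmentIndepSet K, C.support = progression 0 0 n := by
  refine SegmentIndepSet.exists_support_eq (fun p hp => ?_) fun p hp hp' => ?_
  · rw [mem_progression] at hp
    exact Finset.mem_range.2 (by omega)
  · rw [mem_progression] at hp hp'
    omega

theorem pow_three_mul_apply {V : Type*} [AddCommGroup V] [Module ℂ V] (T : Module.End ℂ V)
    (a : ℕ → V) {n : ℕ} (h : ∀ j < n, T (T (T (a j))) = a (j + 1)) :
    ∀ j ≤ n, (T ^ (3 * j)) (a 0) = a j := by
  intro j
  induction j with
  | zero => intro _; simp
  | succ j ih =>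
    intro hj
    rw [← h j (by omega), ← ih (by omega), show 3 * (j + 1) = 3 * j + 1 + 1 + 1 by ring, pow_succ',
      pow_succ', pow_succ', Module.End.mul_apply, Module.End.mul_apply, Module.End.mul_apply]

theorem apply_three_of_smul {V : Type*} [AddCommGroup V] [Module ℂ V] {T : Module.End ℂ V}
    {a b c d : V} {l m n : ℕ} (h1 : T a = (-1 : ℂ) ^ l • b) (h2 : T b = (-1 : ℂ) ^ m • c)
    (h3 : T c = (-1 : ℂ) ^ n • d) : T (T (T a)) = (-1 : ℂ) ^ (l + m + n) • d := by
  rw [h1, map_smul, map_smul, h2, map_smul, h3, smul_smul, smul_smul, pow_add, pow_add, mul_assoc]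

theorem sum_range_three_mul (f : ℕ → ℂ) (n : ℕ) :
    ∑ t ∈ Finset.range (3 * n), f t
      = ∑ i ∈ Finset.range n, (f (3 * i) + f (3 * i + 1) + f (3 * i + 2)) := by
  induction n with
  | zero => simp
  | succ n ih =>
    rw [show 3 * (n + 1) = 3 * n + 1 + 1 + 1 by ring, Finset.sum_range_succ, Finset.sum_range_succ,
      Finset.sum_range_succ, ih, Finset.sum_range_succ]
    ring

/-! ### Orbits of cylinder vectors for the three residues of the width -/

set_option linter.unusedSimpArgs false

/-- For width `3 * k + 1`, the vector of the set `{0, 3, …, 3 * k}`. -/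
noncomputable def pointsOne (k : ℕ) : SegmentIndepSet (3 * k + 1) → ℂ :=
  cylinderVector _ (progression 0 0 (k + 1)) ∅

/-- For width `3 * k + 1`, the vector of the sets that avoid `{0, 3, …, 3 * k}`. -/
noncomputable def edgesOne (k : ℕ) : SegmentIndepSet (3 * k + 1) → ℂ :=
  cylinderVector _ ∅ (progression 0 0 (k + 1))

/-- For width `3 * k + 1`, the vector of the subsets of `{0, 3, …, 3 * k}`. -/
noncomputable def insideOne (k : ℕ) : SegmentIndepSet (3 * k + 1) → ℂ :=
  cylinderVector _ ∅ ((progression 1 0 k) ∪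
    (progression 2 0 k))

/-- Here and in the transitions below, the explicit set passed is the set of left ends of the free
edges, and the exponent is its size plus that of `X`. -/
theorem transferO_pointsOne {k : ℕ} :
    transferO (3 * k + 1) (pointsOne k) = (-1 : ℂ) ^ (k + 1) • edgesOne k := by
  unfold pointsOne edgesOne
  refine toLin'_cylinderVector_of_pred ∅ ?_ ?_ ?_ ?_ ?_ ?_
  · simp only [card_progression, Finset.card_empty]
    try omega
  all_goals
    intro p
    simp only [Finset.mem_union, mem_progression, Finset.notMem_empty, false_or, or_false,
      and_false, not_false_eq_true, true_and, and_true, false_imp_iff, false_iff, iff_false,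
      implies_true]
    try omega

theorem transferO_edgesOne {k : ℕ} :
    transferO (3 * k + 1) (edgesOne k) = (-1 : ℂ) ^ (k) • insideOne k := by
  unfold edgesOne insideOne
  refine toLin'_cylinderVector_of_pred (progression 1 0 k) ?_ ?_ ?_ ?_ ?_ ?_
  · simp only [card_progression, Finset.card_empty]
    try omega
  all_goals
    intro p
    simp only [Finset.mem_union, mem_progression, Finset.notMem_empty, false_or, or_false,
      and_false, not_false_eq_true, true_and, and_true, false_imp_iff, false_iff, iff_false,
      implies_true]
    try omega

theorem transferO_insideOne {k : ℕ} :
    transferO (3 * k + 1) (insideOne k) = (-1 : ℂ) ^ (0) • pointsOne k := by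
  unfold insideOne pointsOne
  refine toLin'_cylinderVector_of_pred ∅ ?_ ?_ ?_ ?_ ?_ ?_
  · simp only [card_progression, Finset.card_empty]
    try omega
  all_goals
    intro p
    simp only [Finset.mem_union, mem_progression, Finset.notMem_empty, false_or, or_false,
      and_false, not_false_eq_true, true_and, and_true, false_imp_iff, false_iff, iff_false,
      implies_true]
    try omega

/-- For width `3 * k + 2`, the sets containing `{0, 3, …}` on the left, with free edges on the right. -/
noncomputable def leftPointsTwo (k j : ℕ) : SegmentIndepSet (3 * k + 2) → ℂ :=
  cylinderVector _ (progression 0 0 (k + 1 - j)) (progression 1 (k + 1 - j) (k + 1))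

/-- For width `3 * k + 2`, free edges on the left and free points on the right. -/
noncomputable def leftEdgesTwo (k j : ℕ) : SegmentIndepSet (3 * k + 2) → ℂ :=
  cylinderVector _ ∅ ((progression 0 0 (k + 1 - j)) ∪
    (progression 2 (k - j) k) ∪
    (progression 0 (k + 1 - j) (k + 1)))

/-- For width `3 * k + 2`, free points on the left and `{…, 3 * k + 1}` on the right. -/
noncomputable def rightPointsTwo (k j : ℕ) : SegmentIndepSet (3 * k + 2) → ℂ :=
  cylinderVector _ (progression 1 (k - j) (k + 1)) ((progression 1 0 (k - j)) ∪
    (progression 2 0 (k - j)))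

/-- The mirror image of `leftPointsTwo`. -/
noncomputable def leftPointsTwoMirror (k j : ℕ) : SegmentIndepSet (3 * k + 2) → ℂ :=
  cylinderVector _ (progression 1 j (k + 1)) (progression 0 0 j)

/-- The mirror image of `leftEdgesTwo`. -/
noncomputable def leftEdgesTwoMirror (k j : ℕ) : SegmentIndepSet (3 * k + 2) → ℂ :=
  cylinderVector _ ∅ ((progression 1 0 (k + 1)) ∪
    (progression 2 0 j))

/-- The mirror image of `rightPointsTwo`. -/
noncomputable def rightPointsTwoMirror (k j : ℕ) : SegmentIndepSet (3 * k + 2) → ℂ :=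
  cylinderVector _ (progression 0 0 (j + 1)) ((progression 2 j k) ∪
    (progression 0 (j + 1) (k + 1)))

theorem transferO_leftPointsTwo {k j : ℕ} (hj : j ≤ k) :
    transferO (3 * k + 2) (leftPointsTwo k j) = (-1 : ℂ) ^ (k + 1) • leftEdgesTwo k j := by
  unfold leftPointsTwo leftEdgesTwo
  refine toLin'_cylinderVector_of_pred (progression 2 (k - j) k) ?_ ?_ ?_ ?_ ?_ ?_
  · simp only [card_progression, Finset.card_empty]
    try omega
  all_goals
    intro p
    simp only [Finset.mem_union, mem_progression, Finset.notMem_empty, false_or, or_false,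
      and_false, not_false_eq_true, true_and, and_true, false_imp_iff, false_iff, iff_false,
      implies_true]
    try omega

theorem transferO_leftEdgesTwo {k j : ℕ} (hj : j ≤ k) :
    transferO (3 * k + 2) (leftEdgesTwo k j) = (-1 : ℂ) ^ (k - j) • rightPointsTwo k j := by
  unfold leftEdgesTwo rightPointsTwo
  refine toLin'_cylinderVector_of_pred (progression 1 0 (k - j)) ?_ ?_ ?_ ?_ ?_ ?_
  · simp only [card_progression, Finset.card_empty]
    try omega
  all_goals
    intro p
    simp only [Finset.mem_union, mem_progression, Finset.notMem_empty, false_or, or_false,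
      and_false, not_false_eq_true, true_and, and_true, false_imp_iff, false_iff, iff_false,
      implies_true]
    try omega

theorem transferO_rightPointsTwo {k j : ℕ} (hj : j < k) :
    transferO (3 * k + 2) (rightPointsTwo k j) = (-1 : ℂ) ^ (j + 1) • leftPointsTwo k (j + 1) := by
  unfold rightPointsTwo leftPointsTwo
  refine toLin'_cylinderVector_of_pred ∅ ?_ ?_ ?_ ?_ ?_ ?_
  · simp only [card_progression, Finset.card_empty]
    try omega
  all_goals
    intro p
    simp only [Finset.mem_union, mem_progression, Finset.notMem_empty, false_or, or_false,
      and_false, not_false_eq_true, true_and, and_true, false_imp_iff, false_iff, iff_false,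
      implies_true]
    try omega

/-- At `j = k` no free edge is left, and the orbit passes to the mirror family. -/
theorem transferO_leftEdgesTwo_self {k : ℕ} :
    transferO (3 * k + 2) (leftEdgesTwo k k) = (-1 : ℂ) ^ (0) • leftPointsTwoMirror k 0 := by
  unfold leftEdgesTwo leftPointsTwoMirror
  refine toLin'_cylinderVector_of_pred ∅ ?_ ?_ ?_ ?_ ?_ ?_
  · simp only [card_progression, Finset.card_empty]
    try omega
  all_goals
    intro p
    simp only [Finset.mem_union, mem_progression, Finset.notMem_empty, false_or, or_false,
      and_false, not_false_eq_true, true_and, and_true, false_imp_iff, false_iff, iff_false,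
      implies_true]
    try omega

theorem transferO_leftPointsTwoMirror {k j : ℕ} (hj : j ≤ k) :
    transferO (3 * k + 2) (leftPointsTwoMirror k j) = (-1 : ℂ) ^ (k + 1) • leftEdgesTwoMirror k j := by
  unfold leftPointsTwoMirror leftEdgesTwoMirror
  refine toLin'_cylinderVector_of_pred (progression 1 0 j) ?_ ?_ ?_ ?_ ?_ ?_
  · simp only [card_progression, Finset.card_empty]
    try omega
  all_goals
    intro p
    simp only [Finset.mem_union, mem_progression, Finset.notMem_empty, false_or, or_false,
      and_false, not_false_eq_true, true_and, and_true, false_imp_iff, false_iff, iff_false,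
      implies_true]
    try omega

theorem transferO_leftEdgesTwoMirror {k j : ℕ} (hj : j ≤ k) :
    transferO (3 * k + 2) (leftEdgesTwoMirror k j) = (-1 : ℂ) ^ (k - j) • rightPointsTwoMirror k j := by
  unfold leftEdgesTwoMirror rightPointsTwoMirror
  refine toLin'_cylinderVector_of_pred (progression 2 j k) ?_ ?_ ?_ ?_ ?_ ?_
  · simp only [card_progression, Finset.card_empty]
    try omega
  all_goals
    intro p
    simp only [Finset.mem_union, mem_progression, Finset.notMem_empty, false_or, or_false,
      and_false, not_false_eq_true, true_and, and_true, false_imp_iff, false_iff, iff_false,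
      implies_true]
    try omega

theorem transferO_rightPointsTwoMirror {k j : ℕ} (hj : j < k) :
    transferO (3 * k + 2) (rightPointsTwoMirror k j) = (-1 : ℂ) ^ (j + 1) • leftPointsTwoMirror k (j + 1) := by
  unfold rightPointsTwoMirror leftPointsTwoMirror
  refine toLin'_cylinderVector_of_pred ∅ ?_ ?_ ?_ ?_ ?_ ?_
  · simp only [card_progression, Finset.card_empty]
    try omega
  all_goals
    intro p
    simp only [Finset.mem_union, mem_progression, Finset.notMem_empty, false_or, or_false,
      and_false, not_false_eq_true, true_and, and_true, false_imp_iff, false_iff, iff_false,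
      implies_true]
    try omega

theorem transferO_leftEdgesTwoMirror_self {k : ℕ} :
    transferO (3 * k + 2) (leftEdgesTwoMirror k k) = (-1 : ℂ) ^ (0) • leftPointsTwo k 0 := by
  unfold leftEdgesTwoMirror leftPointsTwo
  refine toLin'_cylinderVector_of_pred ∅ ?_ ?_ ?_ ?_ ?_ ?_
  · simp only [card_progression, Finset.card_empty]
    try omega
  all_goals
    intro p
    simp only [Finset.mem_union, mem_progression, Finset.notMem_empty, false_or, or_false,
      and_false, not_false_eq_true, true_and, and_true, false_imp_iff, false_iff, iff_false,
      implies_true]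
    try omega

/-- For width `3 * k`, free edges on the left and `{…, 3 * k - 1}` on the right. -/
noncomputable def rightPointsZero (k j : ℕ) : SegmentIndepSet (3 * k) → ℂ :=
  -- For `j = 0` the forbidden set contains `3 * k`, which is off the segment and harmless.
  cylinderVector _ (progression 2 (k - j) k) (progression 0 0 (k + 1 - j))

/-- For width `3 * k`, free points on the left and free edges on the right. -/
noncomputable def rightEdgesZero (k j : ℕ) : SegmentIndepSet (3 * k) → ℂ :=
  cylinderVector _ ∅ ((progression 2 0 k) ∪
    (progression 1 0 (k - j)))

/-- For width `3 * k`, the sets containing `{0, 3, …}` on the left, with free points on the right. -/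
noncomputable def leftPointsZero (k j : ℕ) : SegmentIndepSet (3 * k) → ℂ :=
  cylinderVector _ (progression 0 0 (k + 1 - j)) ((progression 0 (k + 1 - j) k) ∪
    (progression 1 (k + 1 - j) k))

/-- The mirror image of `rightPointsZero`. -/
noncomputable def rightPointsZeroMirror (k j : ℕ) : SegmentIndepSet (3 * k) → ℂ :=
  -- At `j = 0` the truncated `j - 1` drops only the position -1, which is off the segment.
  cylinderVector _ (progression 0 0 j) (progression 2 (j - 1) k)

/-- The mirror image of `rightEdgesZero`. -/
noncomputable def rightEdgesZeroMirror (k j : ℕ) : SegmentIndepSet (3 * k) → ℂ :=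
  cylinderVector _ ∅ ((progression 0 0 k) ∪
    (progression 1 j k))

/-- The mirror image of `leftPointsZero`. -/
noncomputable def leftPointsZeroMirror (k j : ℕ) : SegmentIndepSet (3 * k) → ℂ :=
  cylinderVector _ (progression 2 j k) ((progression 1 0 j) ∪
    (progression 2 0 j))

theorem transferO_rightPointsZero {k j : ℕ} (hj : j ≤ k) :
    transferO (3 * k) (rightPointsZero k j) = (-1 : ℂ) ^ (k) • rightEdgesZero k j := by
  unfold rightPointsZero rightEdgesZero
  refine toLin'_cylinderVector_of_pred (progression 1 0 (k - j)) ?_ ?_ ?_ ?_ ?_ ?_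
  · simp only [card_progression, Finset.card_empty]
    try omega
  all_goals
    intro p
    simp only [Finset.mem_union, mem_progression, Finset.notMem_empty, false_or, or_false,
      and_false, not_false_eq_true, true_and, and_true, false_imp_iff, false_iff, iff_false,
      implies_true]
    try omega

theorem transferO_rightEdgesZero {k j : ℕ} (hj : j < k) :
    transferO (3 * k) (rightEdgesZero k j) = (-1 : ℂ) ^ (j) • leftPointsZero k (j + 1) := by
  unfold rightEdgesZero leftPointsZero
  refine toLin'_cylinderVector_of_pred (progression 0 (k - j) k) ?_ ?_ ?_ ?_ ?_ ?_
  · simp only [card_progression, Finset.card_empty]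
    try omega
  all_goals
    intro p
    simp only [Finset.mem_union, mem_progression, Finset.notMem_empty, false_or, or_false,
      and_false, not_false_eq_true, true_and, and_true, false_imp_iff, false_iff, iff_false,
      implies_true]
    try omega

theorem transferO_leftPointsZero {k j : ℕ} (hj : j < k) :
    transferO (3 * k) (leftPointsZero k (j + 1)) = (-1 : ℂ) ^ (k - j) • rightPointsZero k (j + 1) := by
  unfold leftPointsZero rightPointsZero
  refine toLin'_cylinderVector_of_pred ∅ ?_ ?_ ?_ ?_ ?_ ?_
  · simp only [card_progression, Finset.card_empty]
    try omega
  all_goals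
    intro p
    simp only [Finset.mem_union, mem_progression, Finset.notMem_empty, false_or, or_false,
      and_false, not_false_eq_true, true_and, and_true, false_imp_iff, false_iff, iff_false,
      implies_true]
    try omega

theorem transferO_rightPointsZero_self {k : ℕ} :
    transferO (3 * k) (rightPointsZero k k) = (-1 : ℂ) ^ (k) • rightPointsZeroMirror k 0 := by
  unfold rightPointsZero rightPointsZeroMirror
  refine toLin'_cylinderVector_of_pred ∅ ?_ ?_ ?_ ?_ ?_ ?_
  · simp only [card_progression, Finset.card_empty]
    try omega
  all_goals
    intro p
    simp only [Finset.mem_union, mem_progression, Finset.notMem_empty, false_or, or_false,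
      and_false, not_false_eq_true, true_and, and_true, false_imp_iff, false_iff, iff_false,
      implies_true]
    try omega

theorem transferO_rightPointsZeroMirror {k j : ℕ} (hj : j ≤ k) :
    transferO (3 * k) (rightPointsZeroMirror k j) = (-1 : ℂ) ^ (k) • rightEdgesZeroMirror k j := by
  unfold rightPointsZeroMirror rightEdgesZeroMirror
  refine toLin'_cylinderVector_of_pred (progression 0 j k) ?_ ?_ ?_ ?_ ?_ ?_
  · simp only [card_progression, Finset.card_empty]
    try omega
  all_goals
    intro p
    simp only [Finset.mem_union, mem_progression, Finset.notMem_empty, false_or, or_false,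
      and_false, not_false_eq_true, true_and, and_true, false_imp_iff, false_iff, iff_false,
      implies_true]
    try omega

theorem transferO_rightEdgesZeroMirror {k j : ℕ} (hj : j < k) :
    transferO (3 * k) (rightEdgesZeroMirror k j) = (-1 : ℂ) ^ (j) • leftPointsZeroMirror k j := by
  unfold rightEdgesZeroMirror leftPointsZeroMirror
  refine toLin'_cylinderVector_of_pred (progression 1 0 j) ?_ ?_ ?_ ?_ ?_ ?_
  · simp only [card_progression, Finset.card_empty]
    try omega
  all_goals
    intro p
    simp only [Finset.mem_union, mem_progression, Finset.notMem_empty, false_or, or_false,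
      and_false, not_false_eq_true, true_and, and_true, false_imp_iff, false_iff, iff_false,
      implies_true]
    try omega

theorem transferO_leftPointsZeroMirror {k j : ℕ} (hj : j < k) :
    transferO (3 * k) (leftPointsZeroMirror k j) = (-1 : ℂ) ^ (k - j) • rightPointsZeroMirror k (j + 1) := by
  unfold leftPointsZeroMirror rightPointsZeroMirror
  refine toLin'_cylinderVector_of_pred ∅ ?_ ?_ ?_ ?_ ?_ ?_
  · simp only [card_progression, Finset.card_empty]
    try omega
  all_goals
    intro p
    simp only [Finset.mem_union, mem_progression, Finset.notMem_empty, false_or, or_false,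
      and_false, not_false_eq_true, true_and, and_true, false_imp_iff, false_iff, iff_false,
      implies_true]
    try omega

theorem transferO_rightPointsZeroMirror_self {k : ℕ} :
    transferO (3 * k) (rightPointsZeroMirror k k) = (-1 : ℂ) ^ (k) • rightPointsZero k 0 := by
  unfold rightPointsZeroMirror rightPointsZero
  refine toLin'_cylinderVector_of_pred ∅ ?_ ?_ ?_ ?_ ?_ ?_
  · simp only [card_progression, Finset.card_empty]
    try omega
  all_goals
    intro p
    simp only [Finset.mem_union, mem_progression, Finset.notMem_empty, false_or, or_false,
      and_false, not_false_eq_true, true_and, and_true, false_imp_iff, false_iff, iff_false,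
      implies_true]
    try omega

/-! ### From orbits to eigenvalues -/

theorem neg_one_pow_even_smul {V : Type*} [AddCommGroup V] [Module ℂ V] {n : ℕ} (h : n % 2 = 0)
    (v : V) : (-1 : ℂ) ^ n • v = v := by
  rw [(Nat.even_iff.2 h).neg_one_pow, one_smul]

theorem pow_succ_apply {V : Type*} [AddCommGroup V] [Module ℂ V] (T : Module.End ℂ V) (n : ℕ)
    (v : V) : (T ^ (n + 1)) v = T ((T ^ n) v) := by
  rw [pow_succ', Module.End.mul_apply]

theorem sum_smul_apply_ne_zero {ι : Type*} {T : Module.End ℂ (ι → ℂ)} {v : ι → ℂ} {z : ℂ} {N : ℕ}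
    (i : ι) (h : ∑ t ∈ Finset.range N, z⁻¹ ^ t * (T ^ t) v i ≠ 0) :
    ∑ t ∈ Finset.range N, z⁻¹ ^ t • (T ^ t) v ≠ 0 := by
  intro h0
  apply h
  simpa [Finset.sum_apply] using congrFun h0 i

/-! ### Width `3 * k + 1` -/

theorem hasEigenvalue_transferO_one (k : ℕ) {z : ℂ} (hz : z ^ 3 = -1) (hz1 : z ^ 2 ≠ 1) :
    (transferO (3 * k + 1)).HasEigenvalue z := by
  have hz0 : z ≠ 0 := by rintro rfl; norm_num at hz
  have h3 : (transferO (3 * k + 1) ^ 3) (pointsOne k) = z ^ 3 • pointsOne k := by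
    rw [pow_succ_apply, pow_succ_apply, pow_one,
      apply_three_of_smul transferO_pointsOne transferO_edgesOne transferO_insideOne, hz]
    congr 1
    exact Odd.neg_one_pow ⟨k, by ring⟩
  -- With `n = 0` the test coordinate is the empty set, where the three vectors of the cycle take
  -- the values 0, 1, 1.
  obtain ⟨C, hC⟩ := exists_support_eq_progression (K := 3 * k + 1) (n := 0) (by omega)
  have hC' : ∀ p, p ∉ C.support := by
    intro p; rw [hC, mem_progression]; omega
  have hcard : C.support.card = 0 := Finset.card_eq_zero.2 (Finset.eq_empty_of_forall_notMem hC')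
  refine hasEigenvalue_of_pow_apply hz0 h3 (sum_smul_apply_ne_zero C ?_)
  have e0 : pointsOne k C = 0 :=
    cylinderVector_apply_eq_zero 0 (Or.inl ⟨by rw [mem_progression]; omega, hC' 0⟩)
  have e1 : edgesOne k C = 1 := by
    rw [edgesOne, cylinderVector_apply_eq_pow, hcard, pow_zero]
    exact fun p => ⟨fun h => absurd h (Finset.notMem_empty p), fun h => absurd h (hC' p)⟩
  have e2 : insideOne k C = 1 := by
    rw [insideOne, cylinderVector_apply_eq_pow, hcard, pow_zero]
    exact fun p => ⟨fun h => absurd h (Finset.notMem_empty p), fun h => absurd h (hC' p)⟩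
  rw [Finset.sum_range_succ, Finset.sum_range_succ, Finset.sum_range_one, pow_succ_apply _ 1,
    pow_zero, pow_zero]
  simp only [pow_one, transferO_pointsOne, map_smul, transferO_edgesOne, Module.End.one_apply, Pi.smul_apply, e0, e1, e2, smul_eq_mul, mul_one, mul_zero,
    zero_add, pow_one]
  intro h
  apply hz1
  have hk : ((-1 : ℂ) ^ k) ^ 2 = 1 := by rw [← pow_mul, mul_comm, pow_mul]; norm_num
  -- The two nonzero terms cancel only if z = -(-1)^k, contrary to z² ≠ 1.
  have hzz : z = -(-1) ^ k := by
    rw [pow_succ (-1 : ℂ) k] at h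
    generalize (-1 : ℂ) ^ k = s at h hk
    field_simp at h
    have hs : s ≠ 0 := by rintro rfl; norm_num at hk
    have h' : s * (s + z) = 0 := by linear_combination -h
    rcases mul_eq_zero.1 h' with h' | h'
    · exact absurd h' hs
    · linear_combination h'
  rw [hzz, neg_sq, hk]

/-! ### Width `3 * k + 2` -/

theorem transferO_pow_leftPointsTwo {k j : ℕ} (hj : j ≤ k) :
    (transferO (3 * k + 2) ^ (3 * j)) (leftPointsTwo k 0) = leftPointsTwo k j := by
  refine pow_three_mul_apply _ (leftPointsTwo k) (n := k) (fun i hi => ?_) j hj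
  rw [apply_three_of_smul (transferO_leftPointsTwo hi.le) (transferO_leftEdgesTwo hi.le)
    (transferO_rightPointsTwo hi), neg_one_pow_even_smul (by omega)]

theorem transferO_pow_leftPointsTwoMirror {k j : ℕ} (hj : j ≤ k) :
    (transferO (3 * k + 2) ^ (3 * j)) (leftPointsTwoMirror k 0) = leftPointsTwoMirror k j := by
  refine pow_three_mul_apply _ (leftPointsTwoMirror k) (n := k) (fun i hi => ?_) j hj
  rw [apply_three_of_smul (transferO_leftPointsTwoMirror hi.le) (transferO_leftEdgesTwoMirror hi.le)
    (transferO_rightPointsTwoMirror hi), neg_one_pow_even_smul (by omega)]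

theorem transferO_pow_half_two (k : ℕ) :
    (transferO (3 * k + 2) ^ (3 * k + 2)) (leftPointsTwo k 0)
      = (-1 : ℂ) ^ (k + 1) • leftPointsTwoMirror k 0 := by
  rw [pow_succ_apply, pow_succ_apply,
    transferO_pow_leftPointsTwo le_rfl, transferO_leftPointsTwo le_rfl, map_smul,
    transferO_leftEdgesTwo_self, pow_zero, one_smul]

theorem transferO_pow_half_two_mirror (k : ℕ) :
    (transferO (3 * k + 2) ^ (3 * k + 2)) (leftPointsTwoMirror k 0)
      = (-1 : ℂ) ^ (k + 1) • leftPointsTwo k 0 := by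
  rw [pow_succ_apply, pow_succ_apply,
    transferO_pow_leftPointsTwoMirror le_rfl, transferO_leftPointsTwoMirror le_rfl, map_smul,
    transferO_leftEdgesTwoMirror_self, pow_zero, one_smul]

theorem transferO_pow_full_two (k : ℕ) :
    (transferO (3 * k + 2) ^ (2 * (3 * k + 2))) (leftPointsTwo k 0) = leftPointsTwo k 0 := by
  rw [two_mul, pow_add, Module.End.mul_apply, transferO_pow_half_two, map_smul,
    transferO_pow_half_two_mirror, smul_smul, ← pow_add, neg_one_pow_even_smul (by omega)]

/-- Only `leftPointsTwo` and `leftEdgesTwoMirror` are nonzero at `C`. The latter occurs one step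
after a multiple of 3 in the second half, which starts at `3 * k + 2`, so again at a multiple of 3;
its two signs cancel. -/
theorem transferO_pow_leftPointsTwo_apply {k t : ℕ} (ht : t < 2 * (3 * k + 2))
    {C : SegmentIndepSet (3 * k + 2)} (hC : C.support = progression 0 0 (k + 1)) :
    (transferO (3 * k + 2) ^ t) (leftPointsTwo k 0) C
      = if t % 3 = 0 then Complex.I ^ (k + 1) else 0 := by
  have hcard : C.support.card = k + 1 := by rw [hC, card_progression]; rfl
  have a : ∀ j ≤ k, leftPointsTwo k j C = Complex.I ^ (k + 1) := by
    intro j _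
    rw [leftPointsTwo, cylinderVector_apply_eq_pow, hcard]
    intro p
    simp only [hC, mem_progression]
    omega
  have b : ∀ j ≤ k, leftEdgesTwo k j C = 0 := fun j _ => cylinderVector_apply_eq_zero 0 <| by
    simp only [hC, mem_progression, Finset.mem_union, Finset.notMem_empty, false_and, false_or,
      true_and]
    omega
  have c : ∀ j ≤ k, rightPointsTwo k j C = 0 := fun j _ =>
    cylinderVector_apply_eq_zero (3 * k + 1) <| by
      simp only [hC, mem_progression]
      omega
  have a' : ∀ j ≤ k, leftPointsTwoMirror k j C = 0 := fun j _ =>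
    cylinderVector_apply_eq_zero (3 * k + 1) <| by
      simp only [hC, mem_progression]
      omega
  have b' : ∀ j ≤ k, leftEdgesTwoMirror k j C = Complex.I ^ (k + 1) := by
    intro j _
    rw [leftEdgesTwoMirror, cylinderVector_apply_eq_pow, hcard]
    intro p
    simp only [hC, mem_progression, Finset.mem_union, Finset.notMem_empty, false_imp_iff, true_and]
    omega
  have c' : ∀ j < k, rightPointsTwoMirror k j C = 0 := fun j _ =>
    cylinderVector_apply_eq_zero (3 * k) <| by
      simp only [hC, mem_progression, Finset.mem_union]
      omega
  by_cases h : t < 3 * k + 2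
  · obtain ⟨j, rfl | rfl | rfl⟩ : ∃ j, t = 3 * j ∨ t = 3 * j + 1 ∨ t = 3 * j + 2 :=
      ⟨t / 3, by omega⟩
    · rw [transferO_pow_leftPointsTwo (by omega), a j (by omega), if_pos (by omega)]
    · rw [pow_succ_apply, transferO_pow_leftPointsTwo (by omega),
        transferO_leftPointsTwo (by omega), Pi.smul_apply, b j (by omega), smul_zero,
        if_neg (by omega)]
    · rw [pow_succ_apply, pow_succ_apply,
        transferO_pow_leftPointsTwo (by omega), transferO_leftPointsTwo (by omega), map_smul,
        transferO_leftEdgesTwo (by omega), Pi.smul_apply, Pi.smul_apply, c j (by omega), smul_zero,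
        smul_zero, if_neg (by omega)]
  · obtain ⟨s, rfl⟩ : ∃ s, t = s + (3 * k + 2) := ⟨t - (3 * k + 2), by omega⟩
    rw [pow_add, Module.End.mul_apply, transferO_pow_half_two, map_smul, Pi.smul_apply]
    obtain ⟨j, rfl | rfl | rfl⟩ : ∃ j, s = 3 * j ∨ s = 3 * j + 1 ∨ s = 3 * j + 2 :=
      ⟨s / 3, by omega⟩
    · rw [transferO_pow_leftPointsTwoMirror (by omega), a' j (by omega), smul_zero,
        if_neg (by omega)]
    · rw [pow_succ_apply, transferO_pow_leftPointsTwoMirror (by omega),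
        transferO_leftPointsTwoMirror (by omega), Pi.smul_apply, b' j (by omega), if_pos (by omega),
        smul_smul, ← pow_add, neg_one_pow_even_smul (by omega)]
    · rw [pow_succ_apply, pow_succ_apply,
        transferO_pow_leftPointsTwoMirror (by omega), transferO_leftPointsTwoMirror (by omega),
        map_smul, transferO_leftEdgesTwoMirror (by omega), Pi.smul_apply, Pi.smul_apply,
        c' j (by omega), smul_zero, smul_zero, smul_zero, if_neg (by omega)]

theorem hasEigenvalue_transferO_two (k : ℕ) {z : ℂ} (hz : z ^ (2 * (3 * k + 2)) = 1)
    (hz1 : z ≠ -1) : (transferO (3 * k + 2)).HasEigenvalue z := by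
  have hz0 : z ≠ 0 := by rintro rfl; rw [zero_pow (by omega)] at hz; exact zero_ne_one hz
  obtain ⟨C, hC⟩ := exists_support_eq_progression (K := 3 * k + 2) (n := k + 1) (by omega)
  refine hasEigenvalue_of_pow_apply hz0 (by rw [transferO_pow_full_two, hz, one_smul])
    (sum_smul_apply_ne_zero C ?_)
  rw [Finset.sum_congr rfl fun t ht => by
      rw [transferO_pow_leftPointsTwo_apply (Finset.mem_range.1 ht) hC],
    show 2 * (3 * k + 2) = 3 * (2 * k + 1) + 1 by ring, Finset.sum_range_succ, sum_range_three_mul]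
  have hq : z⁻¹ ^ (6 * k + 4) = 1 := by
    rw [inv_pow, show 6 * k + 4 = 2 * (3 * k + 2) by ring, hz, inv_one]
  have hq1 : z⁻¹ ≠ -1 := fun h => hz1 (by rw [← inv_inv z, h]; norm_num)
  generalize z⁻¹ = q at hq hq1
  have hsum : ∀ i ∈ Finset.range (2 * k + 1),
      (q ^ (3 * i) * (if (3 * i) % 3 = 0 then Complex.I ^ (k + 1) else 0)
        + q ^ (3 * i + 1) * (if (3 * i + 1) % 3 = 0 then Complex.I ^ (k + 1) else 0)
        + q ^ (3 * i + 2) * (if (3 * i + 2) % 3 = 0 then Complex.I ^ (k + 1) else 0))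
      = (q ^ 3) ^ i * Complex.I ^ (k + 1) := by
    intro i _
    rw [if_pos (by omega), if_neg (by omega), if_neg (by omega), pow_mul]
    ring
  rw [Finset.sum_congr rfl hsum, if_pos (by omega), ← Finset.sum_mul, ← add_mul, pow_mul,
    ← Finset.sum_range_succ (fun i => (q ^ 3) ^ i)]
  refine mul_ne_zero (fun h => ?_) (pow_ne_zero _ Complex.I_ne_zero)
  -- Multiplied by 1 - q³, the sum becomes 1 - q^(6k+6) = 1 - q². It can vanish only for q = 1 or
  -- -1, and at q = 1 it is 2k + 2.
  have hgeom := mul_neg_geom_sum (q ^ 3) (2 * k + 1 + 1)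
  rw [h, mul_zero, ← pow_mul] at hgeom
  have h2 : q ^ 2 = 1 := by
    have : q ^ (3 * (2 * k + 1 + 1)) = q ^ (6 * k + 4) * q ^ 2 := by ring
    rw [this, hq] at hgeom
    linear_combination hgeom
  have hq' : q = 1 := (by simpa using h2 : q = 1 ∨ q = -1).resolve_right hq1
  rw [hq'] at h
  simp only [one_pow, Finset.sum_const, Finset.card_range, nsmul_eq_mul, mul_one] at h
  exact absurd h (Nat.cast_ne_zero.2 (by omega))

/-! ### Width `3 * k` -/

theorem transferO_pow_rightPointsZero {k j : ℕ} (hj : j ≤ k) :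
    (transferO (3 * k) ^ (3 * j)) (rightPointsZero k 0) = rightPointsZero k j := by
  refine pow_three_mul_apply _ (rightPointsZero k) (n := k) (fun i hi => ?_) j hj
  rw [apply_three_of_smul (transferO_rightPointsZero hi.le) (transferO_rightEdgesZero hi)
    (transferO_leftPointsZero hi), neg_one_pow_even_smul (by omega)]

theorem transferO_pow_rightPointsZeroMirror {k j : ℕ} (hj : j ≤ k) :
    (transferO (3 * k) ^ (3 * j)) (rightPointsZeroMirror k 0) = rightPointsZeroMirror k j := by
  refine pow_three_mul_apply _ (rightPointsZeroMirror k) (n := k) (fun i hi => ?_) j hj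
  rw [apply_three_of_smul (transferO_rightPointsZeroMirror hi.le)
    (transferO_rightEdgesZeroMirror hi) (transferO_leftPointsZeroMirror hi),
    neg_one_pow_even_smul (by omega)]

theorem transferO_pow_half_zero (k : ℕ) :
    (transferO (3 * k) ^ (3 * k + 1)) (rightPointsZero k 0)
      = (-1 : ℂ) ^ k • rightPointsZeroMirror k 0 := by
  rw [pow_succ_apply, transferO_pow_rightPointsZero le_rfl, transferO_rightPointsZero_self]

theorem transferO_pow_half_zero_mirror (k : ℕ) :
    (transferO (3 * k) ^ (3 * k + 1)) (rightPointsZeroMirror k 0)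
      = (-1 : ℂ) ^ k • rightPointsZero k 0 := by
  rw [pow_succ_apply, transferO_pow_rightPointsZeroMirror le_rfl,
    transferO_rightPointsZeroMirror_self]

theorem transferO_pow_full_zero (k : ℕ) :
    (transferO (3 * k) ^ (2 * (3 * k) + 2)) (rightPointsZero k 0) = rightPointsZero k 0 := by
  rw [show 2 * (3 * k) + 2 = 3 * k + 1 + (3 * k + 1) by ring, pow_add, Module.End.mul_apply,
    transferO_pow_half_zero, map_smul, transferO_pow_half_zero_mirror, smul_smul, ← pow_add,
    neg_one_pow_even_smul (by omega)]

/-- The nonzero values come from `rightEdgesZero` and `rightPointsZeroMirror`, both at times 1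
modulo 3. The exception `t = 2` is `leftPointsZero k 1`, which requires exactly `C` and forbids
nothing. -/
theorem transferO_pow_rightPointsZero_apply {k t : ℕ} (hk : 0 < k) (ht : t < 2 * (3 * k) + 2)
    {C : SegmentIndepSet (3 * k)} (hC : C.support = progression 0 0 k) :
    (transferO (3 * k) ^ t) (rightPointsZero k 0) C
      = if t = 2 ∨ t % 3 = 1 then (-1) ^ k * Complex.I ^ k else 0 := by
  have hcard : C.support.card = k := by rw [hC, card_progression]; rfl
  have b : ∀ j ≤ k, rightPointsZero k j C = 0 := fun j _ => cylinderVector_apply_eq_zero 0 <| by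
    simp only [hC, mem_progression, true_and]
    omega
  have c : ∀ j ≤ k, rightEdgesZero k j C = Complex.I ^ k := by
    intro j _
    rw [rightEdgesZero, cylinderVector_apply_eq_pow, hcard]
    intro p
    simp only [hC, mem_progression, Finset.mem_union, Finset.notMem_empty, false_imp_iff, true_and]
    omega
  have a0 : leftPointsZero k 1 C = Complex.I ^ k := by
    rw [leftPointsZero, cylinderVector_apply_eq_pow, hcard]
    intro p
    simp only [hC, mem_progression, Finset.mem_union]
    omega
  have a : ∀ j ≤ k, 0 < j → leftPointsZero k (j + 1) C = 0 := fun j _ _ =>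
    cylinderVector_apply_eq_zero (3 * (k - 1)) <| by
      simp only [hC, mem_progression, Finset.mem_union]
      omega
  have b' : ∀ j ≤ k, rightPointsZeroMirror k j C = Complex.I ^ k := by
    intro j _
    rw [rightPointsZeroMirror, cylinderVector_apply_eq_pow, hcard]
    intro p
    simp only [hC, mem_progression]
    omega
  have c' : ∀ j ≤ k, rightEdgesZeroMirror k j C = 0 := fun j _ =>
    cylinderVector_apply_eq_zero 0 <| by
      simp only [hC, mem_progression, Finset.mem_union, Finset.notMem_empty, false_and, false_or,
        true_and]
      omega
  have a' : ∀ j < k, leftPointsZeroMirror k j C = 0 := fun j _ =>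
    cylinderVector_apply_eq_zero (3 * j + 2) <| by
      simp only [hC, mem_progression]
      omega
  by_cases h : t < 3 * k + 1
  · obtain ⟨j, rfl | rfl | rfl⟩ : ∃ j, t = 3 * j ∨ t = 3 * j + 1 ∨ t = 3 * j + 2 :=
      ⟨t / 3, by omega⟩
    · rw [transferO_pow_rightPointsZero (by omega), b j (by omega), if_neg (by omega)]
    · rw [pow_succ_apply, transferO_pow_rightPointsZero (by omega),
        transferO_rightPointsZero (by omega), Pi.smul_apply, c j (by omega), smul_eq_mul,
        if_pos (by omega)]
    · rw [pow_succ_apply, pow_succ_apply, transferO_pow_rightPointsZero (by omega),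
        transferO_rightPointsZero (by omega), map_smul, transferO_rightEdgesZero (by omega),
        Pi.smul_apply, Pi.smul_apply]
      rcases Nat.eq_zero_or_pos j with rfl | hj
      · rw [a0, if_pos (by omega), pow_zero, one_smul, smul_eq_mul]
      · rw [a j (by omega) hj, if_neg (by omega), smul_zero, smul_zero]
  · obtain ⟨s, rfl⟩ : ∃ s, t = s + (3 * k + 1) := ⟨t - (3 * k + 1), by omega⟩
    rw [pow_add, Module.End.mul_apply, transferO_pow_half_zero, map_smul, Pi.smul_apply]
    obtain ⟨j, rfl | rfl | rfl⟩ : ∃ j, s = 3 * j ∨ s = 3 * j + 1 ∨ s = 3 * j + 2 :=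
      ⟨s / 3, by omega⟩
    · rw [transferO_pow_rightPointsZeroMirror (by omega), b' j (by omega), smul_eq_mul,
        if_pos (by omega)]
    · rw [pow_succ_apply, transferO_pow_rightPointsZeroMirror (by omega),
        transferO_rightPointsZeroMirror (by omega), Pi.smul_apply, c' j (by omega), smul_zero,
        smul_zero, if_neg (by omega)]
    · rw [pow_succ_apply, pow_succ_apply, transferO_pow_rightPointsZeroMirror (by omega),
        transferO_rightPointsZeroMirror (by omega), map_smul,
        transferO_rightEdgesZeroMirror (by omega), Pi.smul_apply, Pi.smul_apply,
        a' j (by omega), smul_zero, smul_zero, smul_zero, if_neg (by omega)]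

theorem sum_range_ite_two_or_one (q c : ℂ) {n : ℕ} (hn : 0 < n) :
    ∑ t ∈ Finset.range (3 * n), q ^ t * (if t = 2 ∨ t % 3 = 1 then c else 0)
      = (q ^ 2 + q * ∑ i ∈ Finset.range n, (q ^ 3) ^ i) * c := by
  obtain ⟨n, rfl⟩ : ∃ m, n = m + 1 := ⟨n - 1, by omega⟩
  -- The block `i = 0` is split off because it alone contains the exceptional `t = 2`.
  rw [sum_range_three_mul, Finset.sum_range_succ', Finset.sum_range_succ']
  have h : ∀ i ∈ Finset.range n,
      q ^ (3 * (i + 1)) * (if 3 * (i + 1) = 2 ∨ 3 * (i + 1) % 3 = 1 then c else 0)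
        + q ^ (3 * (i + 1) + 1)
          * (if 3 * (i + 1) + 1 = 2 ∨ (3 * (i + 1) + 1) % 3 = 1 then c else 0)
        + q ^ (3 * (i + 1) + 2)
          * (if 3 * (i + 1) + 2 = 2 ∨ (3 * (i + 1) + 2) % 3 = 1 then c else 0)
      = q * c * (q ^ 3) ^ (i + 1) := by
    intro i _
    rw [if_neg (by omega), if_pos (by omega), if_neg (by omega), ← pow_mul]
    ring
  rw [Finset.sum_congr rfl h, ← Finset.mul_sum]
  norm_num
  ring

theorem hasEigenvalue_transferO_zero {k : ℕ} (hk : 0 < k) {z : ℂ} (hz : z ^ (2 * (3 * k) + 2) = 1)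
    (hz1 : z ≠ -1) (hzI : Odd k → z ^ 2 ≠ -1) : (transferO (3 * k)).HasEigenvalue z := by
  have hz0 : z ≠ 0 := by rintro rfl; rw [zero_pow (by omega)] at hz; exact zero_ne_one hz
  obtain ⟨C, hC⟩ := exists_support_eq_progression (K := 3 * k) (n := k) (by omega)
  refine hasEigenvalue_of_pow_apply hz0 (by rw [transferO_pow_full_zero, hz, one_smul])
    (sum_smul_apply_ne_zero C ?_)
  rw [Finset.sum_congr rfl fun t ht => by
      rw [transferO_pow_rightPointsZero_apply hk (Finset.mem_range.1 ht) hC]]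
  -- The added index 6k + 2 is 2 modulo 3, and differs from 2 because k > 0, so its term is zero.
  have hlast : ∑ t ∈ Finset.range (2 * (3 * k) + 2),
      z⁻¹ ^ t * (if t = 2 ∨ t % 3 = 1 then (-1) ^ k * Complex.I ^ k else 0)
      = ∑ t ∈ Finset.range (3 * (2 * k + 1)),
        z⁻¹ ^ t * (if t = 2 ∨ t % 3 = 1 then (-1) ^ k * Complex.I ^ k else 0) := by
    rw [show 3 * (2 * k + 1) = 2 * (3 * k) + 2 + 1 by ring,
      Finset.sum_range_succ _ (2 * (3 * k) + 2), if_neg (by omega), mul_zero, add_zero]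
  rw [hlast, sum_range_ite_two_or_one _ _ (by omega)]
  refine mul_ne_zero (fun h => ?_) (mul_ne_zero (pow_ne_zero _ (by norm_num))
    (pow_ne_zero _ Complex.I_ne_zero))
  have hq : z⁻¹ ^ (6 * k + 2) = 1 := by
    rw [inv_pow, show 6 * k + 2 = 2 * (3 * k) + 2 by ring, hz, inv_one]
  have hq1 : z⁻¹ ≠ -1 := fun h => hz1 (by rw [← inv_inv z, h]; norm_num)
  have hqI : Odd k → z⁻¹ ^ 2 ≠ -1 := fun ho h => hzI ho (by
    rw [← inv_inv z, inv_pow, h]; norm_num)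
  generalize z⁻¹ = q at hq hq1 hqI h
  have hgeom := mul_neg_geom_sum (q ^ 3) (2 * k + 1)
  -- Multiplied by 1 - q³, the sum becomes q² - q⁵ + q - q^(6k+4) = q - q⁵, because q^(6k+2) = 1.
  have h4 : q * (1 - q ^ 4) = 0 := by
    have h3 : (q ^ 3) ^ (2 * k + 1) = q ^ (6 * k + 2) * q := by
      rw [← pow_mul, ← pow_succ]
      congr 1
      ring
    rw [h3, hq] at hgeom
    linear_combination (1 - q ^ 3) * h - q * hgeom
  have hq0 : q ≠ 0 := by rintro rfl; rw [zero_pow (by omega)] at hq; exact zero_ne_one hq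
  have h4' : (1 - q) * ((1 + q) * (1 + q ^ 2)) = 0 := by
    rcases mul_eq_zero.1 h4 with h4 | h4
    · exact absurd h4 hq0
    · linear_combination h4
  rcases mul_eq_zero.1 h4' with h5 | h5
  · have hq' : q = 1 := by linear_combination -h5
    rw [hq'] at h
    simp only [one_pow, Finset.sum_const, Finset.card_range, nsmul_eq_mul, mul_one, one_mul] at h
    rw [show (1 : ℂ) + ((2 * k + 1 : ℕ) : ℂ) = ((2 * k + 2 : ℕ) : ℂ) by push_cast; ring] at h
    exact absurd h (Nat.cast_ne_zero.2 (by omega))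
  · rcases mul_eq_zero.1 h5 with h6 | h6
    · exact hq1 (by linear_combination h6)
    · have hq2 : q ^ 2 = -1 := by linear_combination h6
      refine hqI ?_ hq2
      -- For q² = -1 the relation q^(6k+2) = 1 reads (-1)^(3k+1) = 1, so k is odd.
      rw [show 6 * k + 2 = 2 * (3 * k + 1) by ring, pow_mul, hq2] at hq
      have heven : Even (3 * k + 1) := (neg_one_pow_eq_one_iff_even (by norm_num)).1 hq
      rw [Nat.even_iff] at heven
      rw [Nat.odd_iff]
      omega

/-- At width 0 the only independent set is empty and the matrix is the 1 × 1 identity. The orbit sum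
argument needs k > 0, so this width stands apart. -/
theorem hasEigenvalue_transferO_width_zero : (transferO 0).HasEigenvalue 1 := by
  obtain ⟨C, hC⟩ := exists_support_eq_progression (K := 0) (n := 0) (by omega)
  have h : transferO 0 (cylinderVector 0 ∅ ∅) = (-1 : ℂ) ^ 0 • cylinderVector 0 ∅ ∅ := by
    refine toLin'_cylinderVector_of_pred ∅ rfl ?_ ?_ ?_ ?_ ?_ <;> simp
  rw [pow_zero] at h
  refine Module.End.hasEigenvalue_of_hasEigenvector (x := cylinderVector 0 ∅ ∅)
    ⟨Module.End.mem_eigenspace_iff.2 h, fun h0 => ?_⟩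
  have h1 := congrFun h0 C
  rw [cylinderVector_apply_eq_pow (by simp)] at h1
  exact pow_ne_zero _ Complex.I_ne_zero h1

/-! ### The main theorem -/

theorem exp_pi_div_three_pow {w : ℂ} (hw : w = 1 ∨ w = -1) :
    Complex.exp (w * (Complex.I * Real.pi / 3)) ^ 3 = -1 ∧
      Complex.exp (w * (Complex.I * Real.pi / 3)) ^ 2 ≠ 1 := by
  have h3 : Complex.exp (w * (Complex.I * Real.pi / 3)) ^ 3 = -1 := by
    rw [← Complex.exp_nat_mul]
    rcases hw with rfl | rfl
    · rw [← Complex.exp_pi_mul_I]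
      congr 1
      push_cast
      ring
    · rw [show ((3 : ℕ) : ℂ) * (-1 * (Complex.I * Real.pi / 3)) = -(Real.pi * Complex.I) by
        push_cast; ring, Complex.exp_neg, Complex.exp_pi_mul_I]
      norm_num
  refine ⟨h3, fun h2 => ?_⟩
  have hm : Complex.exp (w * (Complex.I * Real.pi / 3)) = -1 := by
    linear_combination h3 - Complex.exp (w * (Complex.I * Real.pi / 3)) * h2
  have hre := congrArg Complex.re hm
  have hcos : (Complex.exp (w * (Complex.I * Real.pi / 3))).re = 1 / 2 := by
    rw [← Real.cos_pi_div_three]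
    rcases hw with rfl | rfl
    · rw [show (1 : ℂ) * (Complex.I * Real.pi / 3) = ((Real.pi / 3 : ℝ) : ℂ) * Complex.I by
        push_cast; ring, Complex.exp_ofReal_mul_I_re]
    · rw [show (-1 : ℂ) * (Complex.I * Real.pi / 3) = ((-(Real.pi / 3) : ℝ) : ℂ) * Complex.I by
        push_cast; ring, Complex.exp_ofReal_mul_I_re, Real.cos_neg]
  rw [hcos] at hre
  norm_num at hre

theorem mainTheorem8 (K : ℕ) :
    (K % 3 = 1 →
      Module.End.HasEigenvalue (Matrix.toLin' (transferMatrixO K))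
          (Complex.exp (Complex.I * (Real.pi : ℂ) / 3)) ∧
        Module.End.HasEigenvalue (Matrix.toLin' (transferMatrixO K))
          (Complex.exp (-(Complex.I * (Real.pi : ℂ) / 3)))) ∧
    (K % 3 = 2 →
      ∀ z : ℂ, z ^ (2 * K) = 1 → z ≠ -1 →
        Module.End.HasEigenvalue (Matrix.toLin' (transferMatrixO K)) z) ∧
    (K % 3 = 0 →
      ∀ z : ℂ, z ^ (2 * K + 2) = 1 → z ≠ -1 →
        (Odd K → z ≠ Complex.I ∧ z ≠ -Complex.I) →
          Module.End.HasEigenvalue (Matrix.toLin' (transferMatrixO K)) z) := by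

  refine ⟨fun hK => ?_, fun hK z hz hz1 => ?_, fun hK z hz hz1 hzI => ?_⟩
  · obtain ⟨k, rfl⟩ : ∃ k, K = 3 * k + 1 := ⟨K / 3, by omega⟩
    have h1 := exp_pi_div_three_pow (w := 1) (Or.inl rfl)
    have h2 := exp_pi_div_three_pow (w := -1) (Or.inr rfl)
    rw [one_mul] at h1
    rw [neg_one_mul] at h2
    exact ⟨hasEigenvalue_transferO_one k h1.1 h1.2, hasEigenvalue_transferO_one k h2.1 h2.2⟩
  · obtain ⟨k, rfl⟩ : ∃ k, K = 3 * k + 2 := ⟨K / 3, by omega⟩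
    exact hasEigenvalue_transferO_two k hz hz1
  · obtain ⟨k, rfl⟩ : ∃ k, K = 3 * k := ⟨K / 3, by omega⟩
    rcases Nat.eq_zero_or_pos k with rfl | hk
    · have hz' : z = 1 := by
        have h : (z - 1) * (z + 1) = 0 := by
          rw [show 2 * (3 * 0) + 2 = 2 by norm_num] at hz
          linear_combination hz
        rcases mul_eq_zero.1 h with h | h
        · linear_combination h
        · exact absurd (by linear_combination h) hz1
      rw [hz']
      exact hasEigenvalue_transferO_width_zero
    · refine hasEigenvalue_transferO_zero hk hz hz1 fun ho h => ?_
      have h' : (z - Complex.I) * (z + Complex.I) = 0 := by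
        linear_combination h - Complex.I_mul_I
      have hI := hzI (Odd.mul (by decide) ho)
      rcases mul_eq_zero.1 h' with h' | h'
      · exact hI.1 (by linear_combination h')
      · exact hI.2 (by linear_combination h')
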